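/- Let $G$ be an infinite, simple, connected, non-bipartite weighted graph with vertex set $V$ and symmetric edge weights $w(x,y)\ge 1$ for every edge $(x,y)$ (and $w(x,y)=0$ if $(x,y)$ is not an edge), locally finite in the sense that $w(x):=\sum_{y}w(x,y)<\infty$ for every $x\in V$. For $x\in V$ and an integer $r\ge 0$ let $\mathrm{vol}(x,r)=\sum_{y:\,\mathrm{dist}(x,y)\le r}w(y)$, where $\mathrm{dist}$ is the graph distance. Let $p_t(x,y)$ be the $t$-step transition probabilities of simple random walk on $G$, the Markov chain with one-step transition probabilities $p(x,y)=w(x,y)/w(x)$. Let $P$, $(Pf)(x)=\sum_y p(x,y)f(y)$, be its transition operator, which is bounded and self-adjoint on the Hilbert space $\ell^2(V,w)$ with inner product $\langle f,g\rangle_w=\sum_x w(x)f(x)\overline{g(x)}$, let $\mathcal L=I-P$ and $\mathcal Q=I+P$, and let $I_{\mathcal L}$, $I_{\mathcal Q}$ be the resolutions of the identity (spectral projections) of $\mathcal L$ and $\mathcal Q$. With $e_x=\mathbf 1_x/\sqrt{w(x)}$ put $$\mu^*_x(\delta)=\langle I_{\mathcal L}((0,\delta])e_x,e_x\rangle_w,\qquad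 \mu^{\mathcal Q}_x(\delta)=\langle I_{\mathcal Q}([0,\delta])e_x,e_x\rangle_w .$$ Let $x\in V$, and suppose that $c>0$ and $D\ge 1$ are real constants such that $\mathrm{vol}(x,r)\ge c(r+1)^D$ for all integers $r\ge 0$. Then for all $\delta\in(0,2)$, $$\mu^*_x(\delta)\le C\,w(x)\,\delta^{D/(D+1)},\qquad \mu^{\mathcal Q}_x(\delta)\le C\,w(x)\,\delta^{D/(D+1)},\qquad\text{where } C=\frac{(D+1)^2}{c^{1/(D+1)}D^{2D/(D+1)}},$$ and for all integers $t\ge 1$, $$p_t(x,x)\le 2C'\,w(x)\,t^{-D/(D+1)}\ \text{ if } t \text{ is even},\qquad p_t(x,x)\le C'\,w(x)\,t^{-D/(D+1)}\ \text{ if } t\text{ is odd},$$ where $$C'=\frac{D+1}{c^{1/(D+1)}D^{(D-1)/(D+1)}}\,\Gamma\!\Big(\frac{D}{D+1}\Big).$$ -/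

import Mathlib

/-- A simple, connected, weighted graph on the vertex set `V`, locally finite in the sense that the
weights of the edges at each vertex have a finite sum. `weight x y` is the weight of the edge `xy`;
it is extended by `0` to pairs that are not edges. -/
structure WeightedGraph (V : Type*) where
  graph : SimpleGraph V
  weight : V → V → ℝ
  weight_symm : ∀ x y, weight x y = weight y x
  weight_pos : ∀ x y, graph.Adj x y → 0 < weight x y
  weight_eq_zero : ∀ x y, ¬ graph.Adj x y → weight x y = 0
  locallyFinite : ∀ x, Summable (weight x)
  connected : graph.Connected

namespace WeightedGraph

variable {V : Type*}

/-- The weight `w(x)` of a vertex. -/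
noncomputable def vertexWeight (G : WeightedGraph V) (x : V) : ℝ := ∑' y, G.weight x y

/-- The ball `B(x, r)` for the graph distance. -/
def ball (G : WeightedGraph V) (x : V) (r : ℕ) : Set V := {y | G.graph.dist x y ≤ r}

/-- The weight `vol(S)` of a set of vertices, a possibly infinite sum. -/
noncomputable def vol (G : WeightedGraph V) (S : Set V) : ENNReal :=
  ∑' x : S, ENNReal.ofReal (G.vertexWeight x)

/-- The one-step transition probability `p(x, y) = w(x, y) / w(x)` of simple random walk. -/
noncomputable def stepProb (G : WeightedGraph V) (x y : V) : ℝ := G.weight x y / G.vertexWeight x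

open Classical in
/-- The `t`-step transition probability `p_t(x, y)` of simple random walk. -/
noncomputable def heatKernel (G : WeightedGraph V) : ℕ → V → V → ℝ
  | 0, x, y => if x = y then 1 else 0
  | t + 1, x, y => ∑' z, G.stepProb x z * heatKernel G t z y

theorem weight_nonneg (G : WeightedGraph V) (x y : V) : 0 ≤ G.weight x y := by
  by_cases h : G.graph.Adj x y
  · exact (G.weight_pos x y h).le
  · exact (G.weight_eq_zero x y h).ge

theorem vertexWeight_nonneg (G : WeightedGraph V) (x : V) : 0 ≤ G.vertexWeight x :=
  tsum_nonneg (G.weight_nonneg x)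

theorem weight_le_vertexWeight (G : WeightedGraph V) (x y : V) :
    G.weight x y ≤ G.vertexWeight x :=
  (G.locallyFinite x).le_tsum y (fun z _ => G.weight_nonneg x z)

theorem vertexWeight_pos [Nontrivial V] (G : WeightedGraph V) (x : V) : 0 < G.vertexWeight x := by
  obtain ⟨y, hy⟩ := G.connected.preconnected.exists_adj_of_nontrivial x
  exact (G.weight_pos x y hy).trans_le (G.weight_le_vertexWeight x y)

/-- The functions `f : V → ℂ` with `∑ w(x) |f(x)|² < ∞`. -/
def L2Submodule (G : WeightedGraph V) : Submodule ℂ (V → ℂ) where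
  carrier := {f | Summable fun x => G.vertexWeight x * ‖f x‖ ^ 2}
  zero_mem' := by simp
  add_mem' := by
    intro f g hf hg
    refine Summable.of_nonneg_of_le
      (fun x => mul_nonneg (G.vertexWeight_nonneg x) (sq_nonneg _)) (fun x => ?_)
      ((hf.add hg).mul_left 2)
    have h1 : ‖f x + g x‖ ^ 2 ≤ 2 * (‖f x‖ ^ 2 + ‖g x‖ ^ 2) := by
      have := norm_add_le (f x) (g x)
      nlinarith [sq_nonneg (‖f x‖ - ‖g x‖), norm_nonneg (f x + g x)]
    have := mul_le_mul_of_nonneg_left h1 (G.vertexWeight_nonneg x)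
    simp only [Pi.add_apply]
    linarith
  smul_mem' := by
    intro c f hf
    refine (Summable.mul_left (‖c‖ ^ 2) hf).congr (fun x => ?_)
    simp only [Pi.smul_apply, smul_eq_mul, norm_mul]
    ring

/-- The complex Hilbert space `ℓ²(V, w)`. -/
def L2 (G : WeightedGraph V) : Type _ := G.L2Submodule

noncomputable instance (G : WeightedGraph V) : AddCommGroup G.L2 :=
  inferInstanceAs (AddCommGroup G.L2Submodule)

noncomputable instance (G : WeightedGraph V) : Module ℂ G.L2 :=
  inferInstanceAs (Module ℂ G.L2Submodule)

/-- Elements of `ℓ²(V, w)` are functions on `V`. -/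
instance (G : WeightedGraph V) : CoeFun G.L2 (fun _ => V → ℂ) := ⟨fun f => f.1⟩

theorem L2.ext {G : WeightedGraph V} {f g : G.L2} (h : ∀ x, f x = g x) : f = g :=
  Subtype.ext (funext h)

theorem L2.summable {G : WeightedGraph V} (f : G.L2) :
    Summable fun x => G.vertexWeight x * ‖f x‖ ^ 2 := f.2

@[simp] theorem L2.add_apply {G : WeightedGraph V} (f g : G.L2) (x : V) :
    (f + g) x = f x + g x := rfl

@[simp] theorem L2.smul_apply {G : WeightedGraph V} (c : ℂ) (f : G.L2) (x : V) :
    (c • f) x = c * f x := rfl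

@[simp] theorem L2.zero_apply {G : WeightedGraph V} (x : V) : (0 : G.L2) x = 0 := rfl

@[simp] theorem L2.neg_apply {G : WeightedGraph V} (f : G.L2) (x : V) : (-f) x = -f x := rfl

@[simp] theorem L2.sub_apply {G : WeightedGraph V} (f g : G.L2) (x : V) :
    (f - g) x = f x - g x := rfl

theorem L2.summable_inner {G : WeightedGraph V} (f g : G.L2) :
    Summable fun x => (G.vertexWeight x : ℂ) * ((starRingEnd ℂ) (f x) * g x) := by
  refine Summable.of_norm_bounded (f.summable.add g.summable) (fun x => ?_)
  have hw := G.vertexWeight_nonneg x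
  rw [norm_mul, norm_mul, RCLike.norm_conj, Complex.norm_real, Real.norm_of_nonneg hw, ← mul_add]
  refine mul_le_mul_of_nonneg_left ?_ hw
  nlinarith [sq_nonneg (‖f x‖ - ‖g x‖), sq_nonneg ‖f x‖, sq_nonneg ‖g x‖]

theorem L2.inner_self_aux {G : WeightedGraph V} (f : G.L2) :
    ∑' x, (G.vertexWeight x : ℂ) * ((starRingEnd ℂ) (f x) * f x)
      = ((∑' x, G.vertexWeight x * ‖f x‖ ^ 2 : ℝ) : ℂ) := by
  rw [Complex.ofReal_tsum]
  refine tsum_congr (fun x => ?_)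
  rw [RCLike.conj_mul]
  simp

/-- The inner product of `ℓ²(V, w)`, with Mathlib's convention that it is conjugate-linear in the
first variable. -/
@[reducible]
noncomputable def innerCore [Nontrivial V] (G : WeightedGraph V) :
    InnerProductSpace.Core ℂ G.L2 where
  inner f g := ∑' x, (G.vertexWeight x : ℂ) * ((starRingEnd ℂ) (f x) * g x)
  conj_inner_symm f g := by
    rw [Complex.conj_tsum]
    refine tsum_congr (fun x => ?_)
    simp only [map_mul, Complex.conj_ofReal, Complex.conj_conj]
    ring
  re_inner_nonneg f := by
    rw [L2.inner_self_aux]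
    exact tsum_nonneg (fun x => mul_nonneg (G.vertexWeight_nonneg x) (sq_nonneg _))
  add_left f g h := by
    rw [← (L2.summable_inner f h).tsum_add (L2.summable_inner g h)]
    refine tsum_congr (fun x => ?_)
    simp only [L2.add_apply, map_add]
    ring
  smul_left f g c := by
    rw [← tsum_mul_left]
    refine tsum_congr (fun x => ?_)
    simp only [L2.smul_apply, map_mul]
    ring
  definite f hf := by
    rw [L2.inner_self_aux] at hf
    have h : HasSum (fun x => G.vertexWeight x * ‖f x‖ ^ 2) 0 := by
      have h := (L2.summable f).hasSum
      rwa [Complex.ofReal_eq_zero.1 hf] at h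
    rw [hasSum_zero_iff_of_nonneg
        (fun x => mul_nonneg (G.vertexWeight_nonneg x) (sq_nonneg _))] at h
    refine L2.ext (fun x => ?_)
    simpa [(G.vertexWeight_pos x).ne'] using congrFun h x

noncomputable instance [Nontrivial V] (G : WeightedGraph V) : NormedAddCommGroup G.L2 :=
  @InnerProductSpace.Core.toNormedAddCommGroup ℂ G.L2 _ _ _ G.innerCore

noncomputable instance [Nontrivial V] (G : WeightedGraph V) : InnerProductSpace ℂ G.L2 :=
  InnerProductSpace.ofCore G.innerCore.toCore

theorem L2.inner_def [Nontrivial V] {G : WeightedGraph V} (f g : G.L2) :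
    inner ℂ f g = ∑' x, (G.vertexWeight x : ℂ) * ((starRingEnd ℂ) (f x) * g x) := rfl

theorem L2.norm_sq [Nontrivial V] {G : WeightedGraph V} (f : G.L2) :
    ‖f‖ ^ 2 = ∑' x, G.vertexWeight x * ‖f x‖ ^ 2 := by
  rw [← inner_self_eq_norm_sq (𝕜 := ℂ), L2.inner_def, L2.inner_self_aux]
  rfl

/-- Multiplication by `√w` as an isometric isomorphism onto the unweighted space `ℓ²(V)`, used only
to see that `ℓ²(V, w)` is complete. -/
noncomputable def toEll2 [Nontrivial V] (G : WeightedGraph V) :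
    G.L2 ≃ₗᵢ[ℂ] lp (fun _ : V => ℂ) 2 where
  toFun f := ⟨fun x => (Real.sqrt (G.vertexWeight x) : ℂ) * f x, by
    refine memℓp_gen (f.summable.congr (fun x => ?_))
    simp [mul_pow, Real.sq_sqrt (G.vertexWeight_nonneg x)]⟩
  map_add' f g := by
    ext x
    exact mul_add _ _ _
  map_smul' c f := by
    ext x
    exact mul_left_comm _ _ _
  invFun f := ⟨fun x => (Real.sqrt (G.vertexWeight x) : ℂ)⁻¹ * f x, by
    have h := (memℓp_gen_iff (by norm_num : 0 < (2 : ENNReal).toReal)).1 (lp.memℓp f)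
    refine h.congr (fun x => ?_)
    have := (G.vertexWeight_pos x).ne'
    simp [mul_pow, Real.sq_sqrt (G.vertexWeight_nonneg x), this]⟩
  left_inv f := by
    refine L2.ext (fun x => ?_)
    have : (Real.sqrt (G.vertexWeight x) : ℂ) ≠ 0 :=
      Complex.ofReal_ne_zero.2 (Real.sqrt_pos.2 (G.vertexWeight_pos x)).ne'
    change (Real.sqrt (G.vertexWeight x) : ℂ)⁻¹ * ((Real.sqrt (G.vertexWeight x) : ℂ) * f x) = f x
    field_simp
  right_inv f := by
    ext x
    have : (Real.sqrt (G.vertexWeight x) : ℂ) ≠ 0 :=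
      Complex.ofReal_ne_zero.2 (Real.sqrt_pos.2 (G.vertexWeight_pos x)).ne'
    change (Real.sqrt (G.vertexWeight x) : ℂ) * ((Real.sqrt (G.vertexWeight x) : ℂ)⁻¹ * f x) = f x
    field_simp
  norm_map' f := by
    rw [← sq_eq_sq₀ (norm_nonneg _) (norm_nonneg _), L2.norm_sq]
    have h := lp.norm_rpow_eq_tsum (by norm_num : 0 < (2 : ENNReal).toReal)
      (E := fun _ : V => ℂ) (⟨fun x => (Real.sqrt (G.vertexWeight x) : ℂ) * f x, by
        refine memℓp_gen (f.summable.congr (fun x => ?_))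
        simp [mul_pow, Real.sq_sqrt (G.vertexWeight_nonneg x)]⟩ : lp (fun _ : V => ℂ) 2)
    simp only [ENNReal.toReal_ofNat, Real.rpow_ofNat] at h
    refine h.trans (tsum_congr (fun x => ?_))
    simp [mul_pow, Real.sq_sqrt (G.vertexWeight_nonneg x)]

instance [Nontrivial V] (G : WeightedGraph V) : CompleteSpace G.L2 :=
  (completeSpace_congr (e := G.toEll2.toEquiv) G.toEll2.isometry.isUniformEmbedding).2 inferInstance

/-! The transition operator. -/

theorem summable_pair_aux (G : WeightedGraph V) (h : V → ℝ) (h0 : ∀ x, 0 ≤ h x)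
    (hs : Summable fun x => G.vertexWeight x * h x) :
    Summable fun p : V × V => G.weight p.1 p.2 * h p.2 := by
  have h1 : Summable fun p : V × V => G.weight p.1 p.2 * h p.1 := by
    have hn : 0 ≤ fun p : V × V => G.weight p.1 p.2 * h p.1 :=
      fun p => mul_nonneg (G.weight_nonneg _ _) (h0 _)
    refine (summable_prod_of_nonneg hn).2 ⟨fun x => (G.locallyFinite x).mul_right (h x), ?_⟩
    refine hs.congr (fun x => ?_)
    exact tsum_mul_right.symm
  refine ((Equiv.prodComm V V).summable_iff.2 h1).congr (fun p => ?_)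
  simp [G.weight_symm p.1 p.2]

theorem summable_pair {G : WeightedGraph V} (f : G.L2) :
    Summable fun p : V × V => G.weight p.1 p.2 * ‖f p.2‖ ^ 2 :=
  G.summable_pair_aux (fun x => ‖f x‖ ^ 2) (fun _ => sq_nonneg _) (L2.summable f)

theorem tsum_pair {G : WeightedGraph V} (f : G.L2) :
    ∑' x, ∑' y, G.weight x y * ‖f y‖ ^ 2 = ∑' y, G.vertexWeight y * ‖f y‖ ^ 2 := by
  have hc := Summable.tsum_comm (f := fun x y => G.weight x y * ‖f y‖ ^ 2) (summable_pair f)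
  refine hc.symm.trans (tsum_congr (fun y => ?_))
  rw [tsum_mul_right]
  simp only [vertexWeight, G.weight_symm y]

theorem summable_row {G : WeightedGraph V} (f : G.L2) (x : V) :
    Summable fun y => G.weight x y * ‖f y‖ ^ 2 :=
  (summable_pair f).prod_factor x

theorem summable_norm_row {G : WeightedGraph V} (f : G.L2) (x : V) :
    Summable fun y => G.weight x y * ‖f y‖ := by
  refine Summable.of_nonneg_of_le (fun y => mul_nonneg (G.weight_nonneg _ _) (norm_nonneg _))
    (fun y => ?_) ((G.locallyFinite x).add (summable_row f x))
  have : ‖f y‖ ≤ 1 + ‖f y‖ ^ 2 := by nlinarith [sq_nonneg (‖f y‖ - 1), norm_nonneg (f y)]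
  have := mul_le_mul_of_nonneg_left this (G.weight_nonneg x y)
  linarith

theorem summable_stepProb_mul {G : WeightedGraph V} (f : G.L2) (x : V) :
    Summable fun y => (G.stepProb x y : ℂ) * f y := by
  refine Summable.of_norm ?_
  refine ((summable_norm_row f x).mul_left (G.vertexWeight x)⁻¹).congr (fun y => ?_)
  rw [norm_mul, Complex.norm_real, stepProb,
    Real.norm_of_nonneg (div_nonneg (G.weight_nonneg x y) (G.vertexWeight_nonneg x))]
  ring

theorem step_bound [Nontrivial V] {G : WeightedGraph V} (f : G.L2) (x : V) :
    G.vertexWeight x * ‖∑' y, (G.stepProb x y : ℂ) * f y‖ ^ 2 ≤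
      ∑' y, G.weight x y * ‖f y‖ ^ 2 := by
  have hw := G.vertexWeight_pos x
  set a := ∑' y, G.weight x y * ‖f y‖ with ha
  set b := ∑' y, G.weight x y * ‖f y‖ ^ 2 with hb
  have h1 : ‖∑' y, (G.stepProb x y : ℂ) * f y‖ ≤ (G.vertexWeight x)⁻¹ * a := by
    rw [ha, ← tsum_mul_left]
    have e : ∀ y, ‖(G.stepProb x y : ℂ) * f y‖ =
        (G.vertexWeight x)⁻¹ * (G.weight x y * ‖f y‖) := by
      intro y
      rw [norm_mul, Complex.norm_real, stepProb,
        Real.norm_of_nonneg (div_nonneg (G.weight_nonneg x y) (G.vertexWeight_nonneg x))]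
      ring
    simp only [← e]
    refine norm_tsum_le_tsum_norm ?_
    simp only [e]
    exact (summable_norm_row f x).mul_left _
  have h2 : 0 ≤ b - 2 * (a / G.vertexWeight x) * a
      + (a / G.vertexWeight x) ^ 2 * G.vertexWeight x := by
    have e : HasSum (fun y => G.weight x y * (‖f y‖ - a / G.vertexWeight x) ^ 2)
        (b - 2 * (a / G.vertexWeight x) * a + (a / G.vertexWeight x) ^ 2 * G.vertexWeight x) := by
      refine ((((summable_row f x).hasSum).sub
        ((summable_norm_row f x).hasSum.mul_left (2 * (a / G.vertexWeight x)))).add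
        ((G.locallyFinite x).hasSum.mul_left ((a / G.vertexWeight x) ^ 2))).congr_fun ?_
      intro y
      ring
    exact e.nonneg (fun y => mul_nonneg (G.weight_nonneg x y) (sq_nonneg _))
  have h3 : a ^ 2 / G.vertexWeight x ≤ b := by
    have e : b - 2 * (a / G.vertexWeight x) * a + (a / G.vertexWeight x) ^ 2 * G.vertexWeight x
        = b - a ^ 2 / G.vertexWeight x := by
      field_simp
      ring
    linarith
  calc G.vertexWeight x * ‖∑' y, (G.stepProb x y : ℂ) * f y‖ ^ 2
      ≤ G.vertexWeight x * ((G.vertexWeight x)⁻¹ * a) ^ 2 := by gcongr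
    _ = a ^ 2 / G.vertexWeight x := by field_simp
    _ ≤ b := h3

/-- The transition operator `(P f)(x) = ∑ p(x, y) f(y)` on `ℓ²(V, w)`, a contraction. -/
noncomputable def transitionOp [Nontrivial V] (G : WeightedGraph V) : G.L2 →L[ℂ] G.L2 :=
  LinearMap.mkContinuous
    { toFun := fun f => ⟨fun x => ∑' y, (G.stepProb x y : ℂ) * f y,
        Summable.of_nonneg_of_le
          (fun x => mul_nonneg (G.vertexWeight_nonneg x) (sq_nonneg _))
          (fun x => step_bound f x) (summable_pair f).prod⟩
      map_add' := fun f g => L2.ext fun x => by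
        change ∑' y, (G.stepProb x y : ℂ) * (f y + g y) =
          ∑' y, (G.stepProb x y : ℂ) * f y + ∑' y, (G.stepProb x y : ℂ) * g y
        rw [← (summable_stepProb_mul f x).tsum_add (summable_stepProb_mul g x)]
        simp only [mul_add]
      map_smul' := fun c f => L2.ext fun x => by
        change ∑' y, (G.stepProb x y : ℂ) * (c * f y) = c * ∑' y, (G.stepProb x y : ℂ) * f y
        rw [← tsum_mul_left]
        exact tsum_congr fun y => by ring }
    1 (fun f => by
      rw [one_mul, ← sq_le_sq₀ (norm_nonneg _) (norm_nonneg _), L2.norm_sq, L2.norm_sq,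
        ← tsum_pair f]
      exact Summable.tsum_le_tsum (fun x => step_bound f x)
        (Summable.of_nonneg_of_le
          (fun x => mul_nonneg (G.vertexWeight_nonneg x) (sq_nonneg _))
          (fun x => step_bound f x) (summable_pair f).prod) (summable_pair f).prod)

theorem transitionOp_apply [Nontrivial V] (G : WeightedGraph V) (f : G.L2) (x : V) :
    G.transitionOp f x = ∑' y, (G.stepProb x y : ℂ) * f y := rfl

theorem summable_form {G : WeightedGraph V} (f g : G.L2) :
    Summable fun p : V × V =>
      (G.weight p.1 p.2 : ℂ) * ((starRingEnd ℂ) (f p.1) * g p.2) := by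
  have h1 := summable_pair g
  have h2 := (Equiv.prodComm V V).summable_iff.2 (summable_pair f)
  refine Summable.of_norm_bounded (h2.add h1) (fun p => ?_)
  have hw := G.weight_nonneg p.1 p.2
  rw [norm_mul, norm_mul, RCLike.norm_conj, Complex.norm_real, Real.norm_of_nonneg hw]
  simp only [Function.comp, Equiv.prodComm_apply, Prod.fst_swap, Prod.snd_swap]
  rw [G.weight_symm p.2 p.1, ← mul_add]
  refine mul_le_mul_of_nonneg_left ?_ hw
  nlinarith [sq_nonneg (‖f p.1‖ - ‖g p.2‖), sq_nonneg ‖f p.1‖, sq_nonneg ‖g p.2‖]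

theorem inner_transitionOp [Nontrivial V] {G : WeightedGraph V} (f g : G.L2) :
    inner ℂ f (G.transitionOp g) =
      ∑' x, ∑' y, (G.weight x y : ℂ) * ((starRingEnd ℂ) (f x) * g y) := by
  rw [L2.inner_def]
  refine tsum_congr (fun x => ?_)
  rw [transitionOp_apply, ← tsum_mul_left, ← tsum_mul_left]
  refine tsum_congr (fun y => ?_)
  have h : (G.vertexWeight x : ℂ) ≠ 0 := Complex.ofReal_ne_zero.2 (G.vertexWeight_pos x).ne'
  rw [stepProb, Complex.ofReal_div]
  field_simp

/-- `P` is self-adjoint, so that the functional calculus below applies to `ℒ` and `𝒬`. -/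
theorem transitionOp_isSelfAdjoint [Nontrivial V] (G : WeightedGraph V) :
    IsSelfAdjoint G.transitionOp := by
  rw [ContinuousLinearMap.isSelfAdjoint_iff_isSymmetric]
  intro f g
  change inner ℂ (G.transitionOp f) g = inner ℂ f (G.transitionOp g)
  rw [← inner_conj_symm, inner_transitionOp, inner_transitionOp, Complex.conj_tsum]
  have hc := Summable.tsum_comm
    (f := fun x y => (G.weight x y : ℂ) * ((starRingEnd ℂ) (f x) * g y)) (summable_form f g)
  rw [← hc]
  refine tsum_congr (fun x => ?_)
  rw [Complex.conj_tsum]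
  refine tsum_congr (fun y => ?_)
  rw [G.weight_symm x y]
  simp only [map_mul, Complex.conj_ofReal, Complex.conj_conj]
  ring

/-- The probabilistic Laplacian `ℒ = I - P`. -/
noncomputable def laplacian [Nontrivial V] (G : WeightedGraph V) : G.L2 →L[ℂ] G.L2 :=
  1 - G.transitionOp

/-- The probabilistic signless Laplacian `𝒬 = I + P`. -/
noncomputable def signlessLaplacian [Nontrivial V] (G : WeightedGraph V) : G.L2 →L[ℂ] G.L2 :=
  1 + G.transitionOp

open Classical in
/-- The unit vector `e_x = 1_x / √w(x)` of `ℓ²(V, w)`. -/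
noncomputable def unitVec (G : WeightedGraph V) (x : V) : G.L2 :=
  ⟨fun y => if y = x then ((Real.sqrt (G.vertexWeight x))⁻¹ : ℂ) else 0,
    summable_of_ne_finset_zero (s := {x}) (fun y hy => by
      have h : y ≠ x := by simpa using hy
      simp [h])⟩

end WeightedGraph

/-! The resolution of the identity `I_T` of a bounded self-adjoint operator `T`, on intervals. The
positive and negative parts are those of the continuous functional calculus. -/

section SpectralResolution

variable {H : Type*} [NormedAddCommGroup H] [InnerProductSpace ℂ H] [CompleteSpace H]

/-- `I_T((-∞, b])`, the orthogonal projection onto the null space of `(T - b)⁺`. -/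
noncomputable def spectralProjIic (T : H →L[ℂ] H) (b : ℝ) : H →L[ℂ] H :=
  ((T - (b : ℂ) • (1 : H →L[ℂ] H))⁺).ker.starProjection

/-- `I_T([a, ∞))`, the orthogonal projection onto the null space of `(T - a)⁻`. -/
noncomputable def spectralProjIci (T : H →L[ℂ] H) (a : ℝ) : H →L[ℂ] H :=
  ((T - (a : ℂ) • (1 : H →L[ℂ] H))⁻).ker.starProjection

/-- `I_T([a, b]) = I_T((-∞, b]) I_T([a, ∞))`. -/
noncomputable def spectralProjIcc (T : H →L[ℂ] H) (a b : ℝ) : H →L[ℂ] H :=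
  spectralProjIic T b * spectralProjIci T a

/-- `I_T((a, b]) = I_T((-∞, b]) - I_T((-∞, a])` for `a ≤ b`. -/
noncomputable def spectralProjIoc (T : H →L[ℂ] H) (a b : ℝ) : H →L[ℂ] H :=
  spectralProjIic T b - spectralProjIic T a

end SpectralResolution

namespace WeightedGraph

/-- `μ*_x(δ) = ⟨I_ℒ((0, δ]) e_x, e_x⟩_w`. -/
noncomputable def spectralMeasureStar {V : Type*} [Nontrivial V] (G : WeightedGraph V) (x : V)
    (δ : ℝ) : ℝ :=
  RCLike.re (inner ℂ (spectralProjIoc G.laplacian 0 δ (G.unitVec x)) (G.unitVec x))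

/-- `μ^𝒬_x(δ) = ⟨I_𝒬([0, δ]) e_x, e_x⟩_w`. -/
noncomputable def spectralMeasureSignless {V : Type*} [Nontrivial V] (G : WeightedGraph V) (x : V)
    (δ : ℝ) : ℝ :=
  RCLike.re (inner ℂ (spectralProjIcc G.signlessLaplacian 0 δ (G.unitVec x)) (G.unitVec x))

end WeightedGraph

/-! Let `σ = ±1`, so that `1 - σP` is `ℒ` or `𝒬`, and let `f` be the spectral projection of `e_x`
onto `(-∞, δ]`, with `N = ‖f‖²`. Since `f` is a projection of `e_x`, `N = ⟨e_x, f⟩ ≤ √w(x) |f(x)|`,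
so `f` is large at `x`. Since `f` lies in a low spectral subspace, its energy is at most `δN`, and
`|f|` has no larger energy. Edges weigh at least `1`, so Cauchy–Schwarz along a geodesic gives
`(|f(x)| - |f(y)|)² ≤ dist(x,y) δN`. Hence `|f| ≥ (1 - s) N/√w(x)` on a ball of radius about `s²
N/(w(x)δ)`, and the volume of that ball forces `N ≥ c (s² N/(w(x)δ))^D (1 - s)² N²/w(x)`. Solving
for `N`, with the optimal `s = D/(D+1)`, bounds both spectral distributions
(`norm_sq_le_of_energy_le`).

For the return probabilities, `p_t(x,x) = ∫ p^t dν`, where `ν` is the spectral measure of `P` at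
`e_x`. The energy bound, applied to a smoothed projection, controls `ν` near `1` and near `-1`. As
`|p|^t ≤ exp(-t(1 - |p|))`, each half of `[-1, 1]` contributes at most a Laplace transform, which
becomes a Gamma integral. Even times pay for both halves; at odd times the negative half contributes
nothing positive. -/

/-! ### Oscillation of a function of finite energy along geodesics. -/

/-- Telescope along a geodesic and apply Cauchy–Schwarz. The sum runs over ordered pairs, so it
counts each edge twice; hence the `2 * K`. -/
theorem SimpleGraph.sq_sub_le_dist_mul {V : Type*} {G : SimpleGraph V} (hG : G.Connected)
    (w : V → V → ℝ) (hw0 : ∀ y z, 0 ≤ w y z) (hw : ∀ y z, G.Adj y z → 1 ≤ w y z) (h : V → ℝ)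
    {K : ℝ} (hs : Summable fun p : V × V => w p.1 p.2 * (h p.1 - h p.2) ^ 2)
    (hK : ∑' p : V × V, w p.1 p.2 * (h p.1 - h p.2) ^ 2 ≤ 2 * K) (x y : V) :
    (h x - h y) ^ 2 ≤ G.dist x y * K := by
  classical
  obtain ⟨p, hp, hlen⟩ := hG.exists_path_of_dist x y
  rw [← hlen]
  set F : V × V → ℝ := fun p => w p.1 p.2 * (h p.1 - h p.2) ^ 2 with hF
  have hF0 : ∀ q, 0 ≤ F q := fun q => mul_nonneg (hw0 _ _) (sq_nonneg _)
  set R := Finset.range p.length with hR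
  set A : ℕ → V × V := fun i => (p.getVert i, p.getVert (i + 1)) with hA
  set B : ℕ → V × V := fun i => (p.getVert (i + 1), p.getVert i) with hB
  have hinj := hp.getVert_injOn
  have hv : ∀ i j, i ≤ p.length → j ≤ p.length → p.getVert i = p.getVert j → i = j :=
    fun i j hi hj hij => hinj hi hj hij
  have hAinj : Set.InjOn A R := by
    intro i hi j hj hij
    simp only [hR, Finset.coe_range, Set.mem_Iio] at hi hj
    exact hv i j hi.le hj.le (Prod.ext_iff.1 hij).1
  have hBinj : Set.InjOn B R := by
    intro i hi j hj hij
    simp only [hR, Finset.coe_range, Set.mem_Iio] at hi hj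
    exact hv i j hi.le hj.le (Prod.ext_iff.1 hij).2
  -- No edge of the path is traversed in both directions, so the two orientations give distinct
  -- terms of the energy sum.
  have hdisj : Disjoint (R.image A) (R.image B) := by
    rw [Finset.disjoint_left]
    intro q hq hq'
    obtain ⟨i, hi, rfl⟩ := Finset.mem_image.1 hq
    obtain ⟨j, hj, hij⟩ := Finset.mem_image.1 hq'
    rw [hR, Finset.mem_range] at hi hj
    have h1 := hv _ _ hj hi.le (Prod.ext_iff.1 hij).1
    have h2 := hv _ _ hj.le hi (Prod.ext_iff.1 hij).2
    omega
  have hsum := hs.sum_le_tsum (R.image A ∪ R.image B) (fun q _ => hF0 q)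
  rw [Finset.sum_union hdisj, Finset.sum_image hAinj, Finset.sum_image hBinj] at hsum
  have key : ∀ i ∈ R, (h (p.getVert (i + 1)) - h (p.getVert i)) ^ 2 ≤ F (A i) ∧
      (h (p.getVert (i + 1)) - h (p.getVert i)) ^ 2 ≤ F (B i) := by
    intro i hi
    have hadj := p.adj_getVert_succ (Finset.mem_range.1 hi)
    constructor
    · have := mul_le_mul_of_nonneg_right (hw _ _ hadj)
        (sq_nonneg (h (p.getVert i) - h (p.getVert (i + 1))))
      simp only [hF, hA]
      nlinarith
    · have := mul_le_mul_of_nonneg_right (hw _ _ hadj.symm)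
        (sq_nonneg (h (p.getVert (i + 1)) - h (p.getVert i)))
      simp only [hF, hB]
      linarith
  have h1 := Finset.sum_le_sum fun i hi => (key i hi).1
  have h2 := Finset.sum_le_sum fun i hi => (key i hi).2
  have htel := Finset.sum_range_sub (fun i => h (p.getVert i)) p.length
  have hcs := sq_sum_le_card_mul_sum_sq (s := R)
    (f := fun i => h (p.getVert (i + 1)) - h (p.getVert i))
  simp only [SimpleGraph.Walk.getVert_length, SimpleGraph.Walk.getVert_zero] at htel
  rw [htel, Finset.card_range] at hcs
  have hle : ∑ i ∈ R, (h (p.getVert (i + 1)) - h (p.getVert i)) ^ 2 ≤ K := by linarith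
  calc (h x - h y) ^ 2 = (h y - h x) ^ 2 := by ring
    _ ≤ _ := hcs
    _ ≤ _ := mul_le_mul_of_nonneg_left hle (Nat.cast_nonneg _)

/-! ### Energy, volume growth and the bound on `‖f‖²`. -/

namespace WeightedGraph

variable {V : Type*}

theorem hasSum_weight_mul_fst {G : WeightedGraph V} (f : G.L2) :
    HasSum (fun p : V × V => G.weight p.1 p.2 * ‖f p.1‖ ^ 2)
      (∑' y, G.vertexWeight y * ‖f y‖ ^ 2) := by
  have hs : Summable fun p : V × V => G.weight p.1 p.2 * ‖f p.1‖ ^ 2 := by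
    refine ((Equiv.prodComm V V).summable_iff.2 (summable_pair f)).congr (fun p => ?_)
    simp [G.weight_symm p.1 p.2]
  refine hs.hasSum_iff.2 ?_
  rw [hs.tsum_prod]
  refine tsum_congr fun y => ?_
  exact tsum_mul_right (f := fun z => G.weight y z) (a := ‖f y‖ ^ 2)

theorem hasSum_weight_mul_snd {G : WeightedGraph V} (f : G.L2) :
    HasSum (fun p : V × V => G.weight p.1 p.2 * ‖f p.2‖ ^ 2)
      (∑' y, G.vertexWeight y * ‖f y‖ ^ 2) := by
  refine (summable_pair f).hasSum_iff.2 ?_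
  rw [(summable_pair f).tsum_prod, tsum_pair f]

/-- The energy identity for `1 - σ P`. -/
theorem hasSum_energy [Nontrivial V] {G : WeightedGraph V} (f : G.L2) (σ : ℝ) :
    HasSum (fun p : V × V => G.weight p.1 p.2 *
        (‖f p.1‖ ^ 2 + ‖f p.2‖ ^ 2 - 2 * σ * ((starRingEnd ℂ) (f p.1) * f p.2).re))
      (2 * (‖f‖ ^ 2 - σ * (inner ℂ f (G.transitionOp f)).re)) := by
  have h3 : HasSum (fun p : V × V =>
      (G.weight p.1 p.2 : ℂ) * ((starRingEnd ℂ) (f p.1) * f p.2))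
      (inner ℂ f (G.transitionOp f)) := by
    refine (summable_form f f).hasSum_iff.2 ?_
    rw [(summable_form f f).tsum_prod, inner_transitionOp]
  have h4 := Complex.hasSum_re h3
  have h := ((hasSum_weight_mul_fst f).add (hasSum_weight_mul_snd f)).sub (h4.mul_left (2 * σ))
  rw [← L2.norm_sq] at h
  have e : 2 * (‖f‖ ^ 2 - σ * (inner ℂ f (G.transitionOp f)).re) =
      ‖f‖ ^ 2 + ‖f‖ ^ 2 - 2 * σ * (inner ℂ f (G.transitionOp f)).re := by ring
  rw [e]
  refine h.congr_fun fun p => ?_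
  rw [Complex.re_ofReal_mul]
  ring

/-- Passing to `|f|` does not raise the energy, whichever the sign `σ`, because `σ Re(conj f(y)
f(z)) ≤ |f(y)| |f(z)|`. This lets `ℒ` and `𝒬` be treated together. -/
theorem summable_energy_norm [Nontrivial V] {G : WeightedGraph V} (f : G.L2) {σ : ℝ}
    (hσ : |σ| = 1) :
    (Summable fun p : V × V => G.weight p.1 p.2 * (‖f p.1‖ - ‖f p.2‖) ^ 2) ∧
    ∑' p : V × V, G.weight p.1 p.2 * (‖f p.1‖ - ‖f p.2‖) ^ 2 ≤
      2 * (‖f‖ ^ 2 - σ * (inner ℂ f (G.transitionOp f)).re) := by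
  have hE := hasSum_energy f σ
  have hle : ∀ p : V × V, G.weight p.1 p.2 * (‖f p.1‖ - ‖f p.2‖) ^ 2 ≤ G.weight p.1 p.2 *
      (‖f p.1‖ ^ 2 + ‖f p.2‖ ^ 2 - 2 * σ * ((starRingEnd ℂ) (f p.1) * f p.2).re) := by
    intro p
    refine mul_le_mul_of_nonneg_left ?_ (G.weight_nonneg _ _)
    have h1 : |σ * ((starRingEnd ℂ) (f p.1) * f p.2).re| ≤ ‖f p.1‖ * ‖f p.2‖ := by
      rw [abs_mul, hσ, one_mul]
      refine (Complex.abs_re_le_norm _).trans ?_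
      rw [norm_mul, RCLike.norm_conj]
    have h2 := (abs_le.1 h1).2
    nlinarith
  have hs : Summable fun p : V × V => G.weight p.1 p.2 * (‖f p.1‖ - ‖f p.2‖) ^ 2 :=
    Summable.of_nonneg_of_le (fun p => mul_nonneg (G.weight_nonneg _ _) (sq_nonneg _)) hle
      hE.summable
  exact ⟨hs, (hs.tsum_le_tsum hle hE.summable).trans hE.tsum_eq.le⟩

/-- Chebyshev's inequality for the measure `w`. -/
theorem vol_mul_sq_le [Nontrivial V] {G : WeightedGraph V} (f : G.L2) (S : Set V) {m b : ℝ}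
    (hb : 0 ≤ b) (hm : 0 ≤ m) (hS : ∀ y ∈ S, m ≤ ‖f y‖) (hvol : ENNReal.ofReal b ≤ G.vol S) :
    b * m ^ 2 ≤ ‖f‖ ^ 2 := by
  have h1 : ENNReal.ofReal (b * m ^ 2) ≤ ENNReal.ofReal (‖f‖ ^ 2) := by
    rw [ENNReal.ofReal_mul hb, L2.norm_sq, ENNReal.ofReal_tsum_of_nonneg
      (fun y => mul_nonneg (G.vertexWeight_nonneg y) (sq_nonneg _)) f.summable]
    calc _ ≤ G.vol S * ENNReal.ofReal (m ^ 2) := by gcongr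
      _ = ∑' y : S, ENNReal.ofReal (G.vertexWeight y) * ENNReal.ofReal (m ^ 2) := by
        rw [vol, ENNReal.tsum_mul_right]
      _ ≤ ∑' y : S, ENNReal.ofReal (G.vertexWeight y * ‖f y‖ ^ 2) := by
        refine ENNReal.tsum_le_tsum fun y => ?_
        rw [← ENNReal.ofReal_mul (G.vertexWeight_nonneg y)]
        refine ENNReal.ofReal_le_ofReal (mul_le_mul_of_nonneg_left ?_ (G.vertexWeight_nonneg y))
        exact pow_le_pow_left₀ hm (hS y y.2) 2
      _ ≤ _ := ENNReal.tsum_comp_le_tsum_of_injective Subtype.val_injective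
        (fun y => ENNReal.ofReal (G.vertexWeight y * ‖f y‖ ^ 2))
  exact (ENNReal.ofReal_le_ofReal_iff (sq_nonneg _)).1 h1

/-- The constant `(D + 1)² / (c^{1/(D+1)} D^{2D/(D+1)})`. -/
noncomputable def growthConst (c D : ℝ) : ℝ :=
  (D + 1) ^ 2 / (c ^ (1 / (D + 1)) * D ^ (2 * D / (D + 1)))

theorem growthConst_pos {c D : ℝ} (hc : 0 < c) (hD : 1 ≤ D) : 0 < growthConst c D := by
  have : 0 < D := by linarith
  unfold growthConst
  positivity

/-- The constant is `(c s^{2D} (1 - s)²)^{-1/(D+1)}` at `s = D/(D+1)`, the maximizer of `s^{2D} (1 -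
s)²` on `[0, 1]`. -/
theorem growthConst_rpow {c D : ℝ} (hc : 0 < c) (hD : 1 ≤ D) :
    growthConst c D ^ (D + 1) *
      (c * ((D / (D + 1)) ^ 2) ^ D * (1 - D / (D + 1)) ^ 2) = 1 := by
  have hD0 : 0 < D := by linarith
  have hD1 : 0 < D + 1 := by linarith
  have e1 : 1 - D / (D + 1) = 1 / (D + 1) := by field_simp; ring
  have e2 : ((D + 1) ^ 2) ^ (D + 1) = ((D + 1) ^ 2) ^ D * (D + 1) ^ 2 := by
    rw [Real.rpow_add (by positivity), Real.rpow_one]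
  have e3 : (c ^ (1 / (D + 1))) ^ (D + 1) = c := by
    rw [← Real.rpow_mul hc.le, one_div_mul_cancel hD1.ne', Real.rpow_one]
  have e4 : (D ^ (2 * D / (D + 1))) ^ (D + 1) = (D ^ 2) ^ D := by
    rw [← Real.rpow_mul hD0.le, div_mul_cancel₀ _ hD1.ne', ← Real.rpow_natCast D 2,
      ← Real.rpow_mul hD0.le]
    norm_num
  rw [growthConst, e1, Real.div_rpow (by positivity) (by positivity),
    Real.mul_rpow (by positivity) (by positivity), e2, e3, e4, div_pow,
    Real.div_rpow (by positivity) (by positivity)]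
  have : 0 < ((D + 1) ^ 2) ^ D := by positivity
  have : 0 < (D ^ 2) ^ D := by positivity
  field_simp

/-- The left side of `h` has degree `D + 2` in `N`; cancelling one `N` and taking the `(D + 1)`-th
root solves for `N`. -/
theorem le_growthConst_mul {c D w N δ : ℝ} (hc : 0 < c) (hD : 1 ≤ D) (hw : 0 < w) (hN : 0 < N)
    (hδ : 0 < δ)
    (h : c * ((D / (D + 1)) ^ 2 * (N / (w * δ))) ^ D *
      ((1 - D / (D + 1)) * (N / Real.sqrt w)) ^ 2 ≤ N) :
    N ≤ growthConst c D * w * δ ^ (D / (D + 1)) := by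
  have hD0 : 0 < D := by linarith
  have hD1 : 0 < D + 1 := by linarith
  have hC := growthConst_pos hc hD
  rw [← Real.rpow_le_rpow_iff hN.le (by positivity) hD1]
  rw [Real.mul_rpow (by positivity) (by positivity), Real.mul_rpow (by positivity) (by positivity),
    ← Real.rpow_mul hδ.le, div_mul_cancel₀ _ hD1.ne']
  rw [Real.mul_rpow (by positivity) (by positivity), Real.div_rpow hN.le (by positivity),
    Real.mul_rpow hw.le hδ.le, mul_pow, div_pow N, Real.sq_sqrt hw.le] at h
  have hk := growthConst_rpow hc hD
  set A := ((D / (D + 1)) ^ 2) ^ D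
  set s := (1 - D / (D + 1)) ^ 2
  set C := growthConst c D ^ (D + 1)
  have hCp : 0 < C := Real.rpow_pos_of_pos hC _
  have hNp : 0 < N ^ D := by positivity
  have hwp : 0 < w ^ D := by positivity
  have hδp : 0 < δ ^ D := by positivity
  rw [Real.rpow_add hN, Real.rpow_add hw, Real.rpow_one, Real.rpow_one]
  have h2 : (c * A * s) * (N ^ D * N) ≤ w ^ D * w * δ ^ D := by
    have e : c * (A * (N ^ D / (w ^ D * δ ^ D))) * (s * (N ^ 2 / w)) =
        (c * A * s) * (N ^ D * N) * N / (w ^ D * w * δ ^ D) := by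
      field_simp
    rw [e, div_le_iff₀ (by positivity)] at h
    nlinarith
  calc N ^ D * N = C * ((c * A * s) * (N ^ D * N)) := by rw [← mul_assoc, hk, one_mul]
    _ ≤ C * (w ^ D * w * δ ^ D) := mul_le_mul_of_nonneg_left h2 hCp.le
    _ = _ := by ring

/-- If the Rayleigh quotient of `f` for `1 ∓ P` is at most `δ`, and `f` is concentrated at `x`,
then polynomial volume growth bounds the norm of `f`. -/
theorem norm_sq_le_of_energy_le [Nontrivial V] (G : WeightedGraph V)
    (hw : ∀ x y, G.graph.Adj x y → 1 ≤ G.weight x y) (x : V) {c D : ℝ} (hc : 0 < c) (hD : 1 ≤ D)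
    (hvol : ∀ r : ℕ, ENNReal.ofReal (c * ((r : ℝ) + 1) ^ D) ≤ G.vol (G.ball x r))
    {σ : ℝ} (hσ : |σ| = 1) {δ : ℝ} (hδ : 0 < δ) (f : G.L2)
    (hf : ‖f‖ ^ 2 - σ * (inner ℂ f (G.transitionOp f)).re ≤ δ * ‖f‖ ^ 2)
    (hfx : ‖f‖ ^ 2 ≤ Real.sqrt (G.vertexWeight x) * ‖f x‖) :
    ‖f‖ ^ 2 ≤ growthConst c D * G.vertexWeight x * δ ^ (D / (D + 1)) := by
  have hD0 : 0 < D := by linarith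
  have hD1 : 0 < D + 1 := by linarith
  have hwx := G.vertexWeight_pos x
  have hC := growthConst_pos hc hD
  rcases (sq_nonneg ‖f‖).eq_or_lt with h0 | hN
  · rw [← h0]
    positivity
  set N := ‖f‖ ^ 2 with hNdef
  set w := G.vertexWeight x with hwdef
  have hsw : 0 < Real.sqrt w := Real.sqrt_pos.2 hwx
  -- The fraction of the guaranteed height `N / √w` at `x` that may be lost on the ball.
  set s := D / (D + 1) with hs
  have hs0 : 0 < s := by positivity
  have hs1 : s < 1 := by rw [hs, div_lt_one hD1]; linarith
  -- The radius at which the oscillation bound `√(q δ N)` equals `s N / √w`.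
  set q := s ^ 2 * (N / (w * δ)) with hq
  have hq0 : 0 ≤ q := by positivity
  set r := ⌊q⌋₊ with hr
  obtain ⟨hsum, hle⟩ := summable_energy_norm f hσ
  have hdist := G.graph.sq_sub_le_dist_mul G.connected G.weight G.weight_nonneg hw
    (fun y => ‖f y‖) (K := δ * N) hsum (hle.trans (by linarith)) x
  have hfx' : N / Real.sqrt w ≤ ‖f x‖ := by
    rw [div_le_iff₀ hsw]
    linarith
  have hball : ∀ y ∈ G.ball x r, (1 - s) * (N / Real.sqrt w) ≤ ‖f y‖ := by
    intro y hy
    have h1 : (G.graph.dist x y : ℝ) ≤ q :=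
      (Nat.cast_le.2 (show G.graph.dist x y ≤ r from hy)).trans (Nat.floor_le hq0)
    have h2 : (‖f x‖ - ‖f y‖) ^ 2 ≤ (s * (N / Real.sqrt w)) ^ 2 := by
      refine (hdist y).trans ((mul_le_mul_of_nonneg_right h1 (by positivity)).trans_eq ?_)
      rw [hq, mul_pow, div_pow N, Real.sq_sqrt hwx.le]
      field_simp
    have h3 := (le_abs_self _).trans (abs_le_of_sq_le_sq h2 (by positivity))
    linarith
  have hfin := vol_mul_sq_le f _ (by positivity)
    (mul_nonneg (sub_nonneg.2 hs1.le) (by positivity)) hball (hvol r)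
  refine le_growthConst_mul hc hD hwx hN hδ (le_trans ?_ hfin)
  gcongr
  -- Rounding the radius down costs nothing, because the growth hypothesis has `r + 1` in place of
  -- `r`.
  exact (Nat.lt_floor_add_one q).le

end WeightedGraph

/-! ### Spectral projections and spectral measures of bounded self-adjoint operators. -/

open MeasureTheory

theorem re_inner_nonneg_of_nonneg {H : Type*} [NormedAddCommGroup H] [InnerProductSpace ℂ H]
    {T : H →L[ℂ] H} (hT : 0 ≤ T) (v : H) :
    0 ≤ (inner ℂ v (T v)).re :=
  ((ContinuousLinearMap.nonneg_iff_isPositive T).1 hT).re_inner_nonneg_right v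

theorem re_inner_starProjection_self {H : Type*} [NormedAddCommGroup H]
    [InnerProductSpace ℂ H] (K : Submodule ℂ H)
    [K.HasOrthogonalProjection] (v : H) :
    (inner ℂ (K.starProjection v) v).re = ‖K.starProjection v‖ ^ 2 := by
  have h := Submodule.starProjection_inner_eq_zero v _ (K.starProjection_apply_mem v)
  rw [inner_sub_left, sub_eq_zero] at h
  rw [← inner_conj_symm, h, Complex.conj_re]
  exact inner_self_eq_norm_sq (𝕜 := ℂ) _

section SpectralTheory

variable {H : Type*} [NormedAddCommGroup H] [InnerProductSpace ℂ H] [CompleteSpace H]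

/-- On the kernel of `(T - b)⁺` the operator `T - b` acts as `-(T - b)⁻`, which is nonpositive. -/
theorem inner_spectralProjIic_le {T : H →L[ℂ] H} (hT : IsSelfAdjoint T) (b : ℝ) (v : H) :
    (inner ℂ (spectralProjIic T b v) (T (spectralProjIic T b v))).re ≤
      b * ‖spectralProjIic T b v‖ ^ 2 := by
  set S : H →L[ℂ] H := T - (b : ℂ) • (1 : H →L[ℂ] H) with hS
  have hSa : IsSelfAdjoint S := hT.sub (IsSelfAdjoint.smul (by simp [IsSelfAdjoint]) (.one _))
  set f := spectralProjIic T b v with hf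
  have hker : S⁺ f = 0 := Submodule.starProjection_apply_mem (S⁺).ker v
  have h1 : S f = - S⁻ f := by
    conv_lhs => rw [← CFC.posPart_sub_negPart S hSa]
    rw [sub_apply, hker, zero_sub]
  have h2 : T f = - S⁻ f + (b : ℂ) • f := by
    rw [← h1, hS]
    simp
  have h3 := re_inner_nonneg_of_nonneg (CFC.negPart_nonneg S) f
  rw [h2, inner_add_right, inner_neg_right, inner_smul_right, inner_self_eq_norm_sq_to_K]
  simp only [Complex.add_re, Complex.neg_re, Complex.re_ofReal_mul]
  have : (((‖f‖ : ℝ) : ℂ) ^ 2).re = ‖f‖ ^ 2 := by norm_cast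
  have h4 : (((RCLike.ofReal ‖f‖ : ℂ)) ^ 2).re = ‖f‖ ^ 2 := this
  rw [h4]
  linarith

theorem spectralProjIcc_zero_of_nonneg {T : H →L[ℂ] H} (hT : 0 ≤ T) (b : ℝ) :
    spectralProjIcc T 0 b = spectralProjIic T b := by
  have h : (T - ((0 : ℝ) : ℂ) • (1 : H →L[ℂ] H))⁻ = 0 := by
    rw [Complex.ofReal_zero, zero_smul, sub_zero]
    exact (CFC.negPart_eq_zero_iff T (IsSelfAdjoint.of_nonneg hT)).2 hT
  have h1 : spectralProjIci T 0 = 1 := by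
    ext v
    rw [spectralProjIci, one_apply_eq_self]
    exact Submodule.starProjection_eq_self_iff.2 (by rw [h]; simp)
  rw [spectralProjIcc, h1, mul_one]

/-- The subtracted projection contributes `-‖spectralProjIic T a v‖²`, which is dropped. -/
theorem re_inner_spectralProjIoc_le (T : H →L[ℂ] H) (a b : ℝ) (v : H) :
    (inner ℂ (spectralProjIoc T a b v) v).re ≤ ‖spectralProjIic T b v‖ ^ 2 := by
  rw [spectralProjIoc, sub_apply, inner_sub_left, Complex.sub_re]
  have h1 := re_inner_starProjection_self ((T - (b : ℂ) • (1 : H →L[ℂ] H))⁺).ker v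
  have h2 := re_inner_starProjection_self ((T - (a : ℂ) • (1 : H →L[ℂ] H))⁺).ker v
  have h3 := sq_nonneg ‖spectralProjIic T a v‖
  simp only [spectralProjIic] at h3 ⊢
  linarith

/-- The spectral measure of a bounded self-adjoint operator at a vector. -/
theorem exists_spectralMeasure {T : H →L[ℂ] H} (hT : IsSelfAdjoint T) (v : H) :
    ∃ ν : Measure ℝ, IsFiniteMeasure ν ∧ (∀ᵐ s ∂ν, s ∈ spectrum ℝ T) ∧
      ∀ f : ℝ → ℝ, Continuous f → ∫ s, f s ∂ν = (inner ℂ v (cfc f T v)).re := by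
  -- Riesz–Markov is applied to the positive functional `f ↦ ⟨v, f(T) v⟩`; the spectrum is compact,
  -- so compact support is no restriction.
  let Λ₀ : CompactlySupportedContinuousMap (spectrum ℝ T) ℝ →ₗ[ℝ] ℝ :=
    { toFun := fun f => (inner ℂ v (cfcHom hT (f : C(spectrum ℝ T, ℝ)) v)).re
      map_add' := fun f g => by
        have : ((f + g : CompactlySupportedContinuousMap (spectrum ℝ T) ℝ) :
          C(spectrum ℝ T, ℝ)) = (f : C(spectrum ℝ T, ℝ)) + g := rfl
        rw [this, map_add, add_apply, inner_add_right, Complex.add_re]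
      map_smul' := fun r f => by
        have : ((r • f : CompactlySupportedContinuousMap (spectrum ℝ T) ℝ) :
          C(spectrum ℝ T, ℝ)) = r • (f : C(spectrum ℝ T, ℝ)) := rfl
        rw [this, map_smul, smul_apply, inner_smul_right_eq_smul,
          Complex.smul_re, RingHom.id_apply] }
  let Λ : CompactlySupportedContinuousMap (spectrum ℝ T) ℝ →ₚ[ℝ] ℝ :=
    PositiveLinearMap.mk₀ Λ₀ fun f hf =>
      re_inner_nonneg_of_nonneg ((cfcHom_nonneg_iff hT).2 fun s => hf s) v
  have hcpt : CompactSpace (spectrum ℝ T) :=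
    ContinuousFunctionalCalculus.compactSpace_spectrum (R := ℝ) (p := IsSelfAdjoint) T
  set ν₀ := RealRMK.rieszMeasure Λ with hν₀
  have hemb : MeasurableEmbedding (Subtype.val : spectrum ℝ T → ℝ) :=
    MeasurableEmbedding.subtype_coe (spectrum.isClosed (𝕜 := ℝ) T).measurableSet
  refine ⟨ν₀.map Subtype.val, inferInstance, ?_, fun f hf => ?_⟩
  · rw [hemb.ae_map_iff]
    exact Filter.Eventually.of_forall fun s => s.2
  · rw [hemb.integral_map]
    let F : C(spectrum ℝ T, ℝ) := ⟨fun s => f s, hf.comp continuous_subtype_val⟩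
    have h := RealRMK.integral_rieszMeasure Λ
      (CompactlySupportedContinuousMap.continuousMapEquiv F)
    refine h.trans ?_
    rw [cfc_apply f T hT hf.continuousOn]
    rfl

theorem spectrum_subset_Icc_of_norm_le_one {T : H →L[ℂ] H} (hT : ‖T‖ ≤ 1) {s : ℝ}
    (hs : s ∈ spectrum ℝ T) : s ∈ Set.Icc (-1 : ℝ) 1 := by
  rcases subsingleton_or_nontrivial H with hH | hH
  · exact absurd hs (by simp [spectrum.of_subsingleton])
  · have h := (spectrum.norm_le_norm_of_mem hs).trans hT
    exact abs_le.1 h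

theorem one_add_nonneg_of_norm_le_one {T : H →L[ℂ] H} (hT : IsSelfAdjoint T) (h : ‖T‖ ≤ 1) :
    0 ≤ 1 + T := by
  have e : 1 + T = cfc (fun s : ℝ => 1 + s) T := by
    rw [cfc_const_add (1 : ℝ) (fun s => s) T (by fun_prop) hT, cfc_id' ℝ T hT, map_one]
  rw [e]
  exact cfc_nonneg fun s hs => by linarith [(spectrum_subset_Icc_of_norm_le_one h hs).1]

end SpectralTheory

/-! ### Laplace transform of a measure with polynomially bounded distribution function. -/

/-- A measure on `[0, ∞)` with distribution function at most `B sᵃ` has its Laplace transform at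
most `B Γ(a + 1) t⁻ᵃ`. -/
theorem lintegral_exp_neg_mul_le {ν : Measure ℝ} [SFinite ν] {B a t : ℝ} (hB : 0 ≤ B)
    (ha : 0 < a) (ht : 0 < t) (h0 : ∀ᵐ l ∂ν, 0 ≤ l)
    (hν : ∀ s, 0 < s → ν (Set.Iic s) ≤ ENNReal.ofReal (B * s ^ a)) :
    ∫⁻ l, ENNReal.ofReal (Real.exp (-(t * l))) ∂ν ≤
      ENNReal.ofReal (B * Real.Gamma (a + 1) * t ^ (-a)) := by
  have hmeas : Measurable fun s : ℝ => ENNReal.ofReal (t * Real.exp (-(t * s))) := by fun_prop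
  -- Writing `exp(-tl) = ∫_l^∞ t exp(-ts) ds` and exchanging integrals turns the transform into `∫ t
  -- exp(-ts) ν((-∞, s]) ds`, an integration by parts.
  have h1 : ∀ l : ℝ, 0 ≤ l → ENNReal.ofReal (Real.exp (-(t * l))) =
      ∫⁻ s in Set.Ioi 0, (Set.Ici l).indicator
        (fun s => ENNReal.ofReal (t * Real.exp (-(t * s)))) s := by
    intro l hl
    have hint : IntegrableOn (fun s => t * Real.exp (-(t * s))) (Set.Ioi l) := by
      have := (integrableOn_exp_mul_Ioi (neg_lt_zero.2 ht) l).const_mul t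
      simp only [neg_mul] at this
      exact this
    have hval : ∫ s in Set.Ioi l, t * Real.exp (-(t * s)) = Real.exp (-(t * l)) := by
      have := integral_exp_mul_Ioi (neg_lt_zero.2 ht) l
      simp only [neg_mul] at this
      rw [integral_const_mul, this]
      field_simp
    rw [lintegral_indicator measurableSet_Ici, Measure.restrict_restrict measurableSet_Ici,
      ← hval, ofReal_integral_eq_lintegral_ofReal hint
        (Filter.Eventually.of_forall fun s => by positivity)]
    refine setLIntegral_congr ?_
    rcases hl.eq_or_lt with rfl | hl
    · rw [Set.inter_eq_right.2 Set.Ioi_subset_Ici_self]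
      exact Filter.EventuallyEq.rfl
    · rw [Set.inter_eq_left.2 (Set.Ici_subset_Ioi.2 hl)]
      exact Ioi_ae_eq_Ici
  rw [lintegral_congr_ae (h0.mono h1), lintegral_lintegral_swap]
  -- The exponent is left as `a + 1 - 1` to match the integrand of `Γ(a + 1)`.
  · have h2 : ∀ s ∈ Set.Ioi (0 : ℝ), ∫⁻ l, (Set.Ici l).indicator
        (fun s => ENNReal.ofReal (t * Real.exp (-(t * s)))) s ∂ν ≤
        ENNReal.ofReal (B * t * (s ^ (a + 1 - 1) * Real.exp (-(t * s)))) := by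
      intro s hs
      have hs0 : 0 < s := hs
      have e : ∀ l, (Set.Ici l).indicator
          (fun s => ENNReal.ofReal (t * Real.exp (-(t * s)))) s =
          (Set.Iic s).indicator (fun _ => ENNReal.ofReal (t * Real.exp (-(t * s)))) l := by
        intro l
        simp [Set.indicator_apply]
      simp only [e]
      rw [lintegral_indicator_const measurableSet_Iic]
      refine (mul_le_mul_right (hν s hs) _).trans_eq ?_
      rw [← ENNReal.ofReal_mul (by positivity)]
      congr 1
      rw [add_sub_cancel_right]
      ring
    refine (setLIntegral_mono' measurableSet_Ioi h2).trans_eq ?_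
    have hg := Real.integral_rpow_mul_exp_neg_mul_Ioi (a := a + 1) (r := t) (by linarith) ht
    have hgi : IntegrableOn (fun s : ℝ => s ^ (a + 1 - 1) * Real.exp (-(t * s)))
        (Set.Ioi 0) := by
      -- A non-integrable function has integral `0` by convention, whereas the Gamma integral is
      -- positive.
      refine not_not.1 fun hn => ?_
      have h3 := integral_undef hn
      rw [h3] at hg
      have := Real.Gamma_pos_of_pos (show 0 < a + 1 by linarith)
      have : 0 < (1 / t) ^ (a + 1) * Real.Gamma (a + 1) := by positivity
      linarith
    rw [← ofReal_integral_eq_lintegral_ofReal (hgi.const_mul _), integral_const_mul, hg]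
    · congr 1
      rw [one_div, Real.inv_rpow ht.le, Real.rpow_add ht, Real.rpow_one, Real.rpow_neg ht.le]
      field_simp
    · refine (ae_restrict_iff' measurableSet_Ioi).2 (Filter.Eventually.of_forall fun s hs => ?_)
      have hs0 : 0 < s := hs
      simp only [Pi.zero_apply]
      positivity
  · have hset : MeasurableSet {p : ℝ × ℝ | p.1 ≤ p.2} := measurableSet_le measurable_fst measurable_snd
    have : (Function.uncurry fun l s => (Set.Ici l).indicator
        (fun s => ENNReal.ofReal (t * Real.exp (-(t * s)))) s) =
        {p : ℝ × ℝ | p.1 ≤ p.2}.indicator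
          (fun p => ENNReal.ofReal (t * Real.exp (-(t * p.2)))) := by
      funext p
      simp [Function.uncurry, Set.indicator_apply]
    rw [this]
    exact ((hmeas.comp measurable_snd).indicator hset).aemeasurable

/-! ### Spectral distributions of `ℒ` and `𝒬` at `e_x`. -/

namespace WeightedGraph

variable {V : Type*}

theorem unitVec_apply_self (G : WeightedGraph V) (x : V) :
    G.unitVec x x = ((Real.sqrt (G.vertexWeight x))⁻¹ : ℂ) := if_pos rfl

theorem unitVec_apply_of_ne (G : WeightedGraph V) {x y : V} (h : y ≠ x) : G.unitVec x y = 0 :=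
  if_neg h

theorem inner_unitVec [Nontrivial V] (G : WeightedGraph V) (x : V) (f : G.L2) :
    inner ℂ (G.unitVec x) f = (Real.sqrt (G.vertexWeight x) : ℂ) * f x := by
  have hw := G.vertexWeight_pos x
  rw [L2.inner_def, tsum_eq_single x]
  · have h : (Real.sqrt (G.vertexWeight x) : ℂ) ≠ 0 :=
      Complex.ofReal_ne_zero.2 (Real.sqrt_pos.2 hw).ne'
    have h2 : (G.vertexWeight x : ℂ) =
        (Real.sqrt (G.vertexWeight x) : ℂ) * (Real.sqrt (G.vertexWeight x) : ℂ) := by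
      rw [← Complex.ofReal_mul, Real.mul_self_sqrt hw.le]
    rw [unitVec_apply_self, map_inv₀, Complex.conj_ofReal]
    conv_lhs => rw [h2]
    field_simp
  · intro y hy
    simp [unitVec_apply_of_ne G hy]

theorem transitionOp_pow_unitVec [Nontrivial V] (G : WeightedGraph V) (x : V) (t : ℕ) (y : V) :
    (G.transitionOp ^ t) (G.unitVec x) y =
      (G.heatKernel t y x : ℂ) * ((Real.sqrt (G.vertexWeight x))⁻¹ : ℂ) := by
  induction t generalizing y with
  | zero =>
    by_cases h : y = x
    · simp [h, unitVec_apply_self, heatKernel]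
    · simp [h, unitVec_apply_of_ne G h, heatKernel]
  | succ t ih =>
    rw [pow_succ', mul_apply_eq_comp, transitionOp_apply, heatKernel,
      Complex.ofReal_tsum, ← tsum_mul_right]
    refine tsum_congr fun z => ?_
    rw [ih]
    push_cast
    ring

theorem heatKernel_self_eq [Nontrivial V] (G : WeightedGraph V) (x : V) (t : ℕ) :
    G.heatKernel t x x =
      (inner ℂ (G.unitVec x) ((G.transitionOp ^ t) (G.unitVec x))).re := by
  have h : (Real.sqrt (G.vertexWeight x) : ℂ) ≠ 0 :=
    Complex.ofReal_ne_zero.2 (Real.sqrt_pos.2 (G.vertexWeight_pos x)).ne'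
  rw [inner_unitVec, transitionOp_pow_unitVec, mul_comm, mul_assoc, inv_mul_cancel₀ h, mul_one,
    Complex.ofReal_re]

theorem norm_transitionOp_le_one [Nontrivial V] (G : WeightedGraph V) : ‖G.transitionOp‖ ≤ 1 :=
  LinearMap.mkContinuous_norm_le _ zero_le_one _

theorem re_inner_unitVec_le [Nontrivial V] (G : WeightedGraph V) (x : V) (f : G.L2) :
    (inner ℂ (G.unitVec x) f).re ≤ Real.sqrt (G.vertexWeight x) * ‖f x‖ := by
  rw [inner_unitVec, Complex.re_ofReal_mul]
  exact mul_le_mul_of_nonneg_left (Complex.re_le_norm _) (Real.sqrt_nonneg _)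

theorem signlessLaplacian_nonneg [Nontrivial V] (G : WeightedGraph V) :
    0 ≤ G.signlessLaplacian :=
  one_add_nonneg_of_norm_le_one G.transitionOp_isSelfAdjoint G.norm_transitionOp_le_one

/-- The projection `f` of `e_x` meets both hypotheses of the energy bound: its Rayleigh quotient is
at most `δ`, and `‖f‖² = ⟨e_x, f⟩`. -/
theorem norm_sq_spectralProjIic_le [Nontrivial V] (G : WeightedGraph V)
    (hw : ∀ x y, G.graph.Adj x y → 1 ≤ G.weight x y) (x : V) {c D : ℝ} (hc : 0 < c) (hD : 1 ≤ D)
    (hvol : ∀ r : ℕ, ENNReal.ofReal (c * ((r : ℝ) + 1) ^ D) ≤ G.vol (G.ball x r))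
    {σ : ℝ} (hσ : |σ| = 1) {δ : ℝ} (hδ : 0 < δ) {T : G.L2 →L[ℂ] G.L2}
    (hT : T = 1 - (σ : ℂ) • G.transitionOp) :
    ‖spectralProjIic T δ (G.unitVec x)‖ ^ 2 ≤
      growthConst c D * G.vertexWeight x * δ ^ (D / (D + 1)) := by
  have hTa : IsSelfAdjoint T := by
    rw [hT]
    exact (IsSelfAdjoint.one _).sub
      (IsSelfAdjoint.smul (by simp [IsSelfAdjoint]) G.transitionOp_isSelfAdjoint)
  refine G.norm_sq_le_of_energy_le hw x hc hD hvol hσ hδ _ ?_ ?_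
  · have h := inner_spectralProjIic_le hTa δ (G.unitVec x)
    set f := spectralProjIic T δ (G.unitVec x)
    have e : (inner ℂ f (T f)).re = ‖f‖ ^ 2 - σ * (inner ℂ f (G.transitionOp f)).re := by
      rw [hT, sub_apply, smul_apply, one_apply_eq_self, inner_sub_right, inner_smul_right,
        Complex.sub_re, Complex.re_ofReal_mul]
      congr 1
      exact inner_self_eq_norm_sq (𝕜 := ℂ) f
    rwa [e] at h
  · refine le_trans ?_ (G.re_inner_unitVec_le x _)
    rw [← inner_conj_symm, Complex.conj_re]
    exact (re_inner_starProjection_self _ _).ge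

theorem spectralMeasureStar_le [Nontrivial V] (G : WeightedGraph V)
    (hw : ∀ x y, G.graph.Adj x y → 1 ≤ G.weight x y) (x : V) {c D : ℝ} (hc : 0 < c) (hD : 1 ≤ D)
    (hvol : ∀ r : ℕ, ENNReal.ofReal (c * ((r : ℝ) + 1) ^ D) ≤ G.vol (G.ball x r))
    {δ : ℝ} (hδ : 0 < δ) :
    G.spectralMeasureStar x δ ≤ growthConst c D * G.vertexWeight x * δ ^ (D / (D + 1)) :=
  (re_inner_spectralProjIoc_le _ _ _ _).trans
    (G.norm_sq_spectralProjIic_le hw x hc hD hvol (σ := 1) abs_one hδ (by simp [laplacian]))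

theorem spectralMeasureSignless_le [Nontrivial V] (G : WeightedGraph V)
    (hw : ∀ x y, G.graph.Adj x y → 1 ≤ G.weight x y) (x : V) {c D : ℝ} (hc : 0 < c) (hD : 1 ≤ D)
    (hvol : ∀ r : ℕ, ENNReal.ofReal (c * ((r : ℝ) + 1) ^ D) ≤ G.vol (G.ball x r))
    {δ : ℝ} (hδ : 0 < δ) :
    G.spectralMeasureSignless x δ ≤ growthConst c D * G.vertexWeight x * δ ^ (D / (D + 1)) := by
  rw [spectralMeasureSignless, spectralProjIcc_zero_of_nonneg G.signlessLaplacian_nonneg]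
  exact (re_inner_starProjection_self _ _).le.trans
    (G.norm_sq_spectralProjIic_le hw x hc hD hvol (σ := -1) (by simp) hδ
      (by
        have h : (-1 : ℂ) • G.transitionOp = -G.transitionOp := neg_one_smul ℂ G.transitionOp
        rw [signlessLaplacian, Complex.ofReal_neg, Complex.ofReal_one, h, sub_neg_eq_add]))

/-! ### Distribution of the spectral measure of `P` near `1` and near `-1`. -/

/-- The continuous cutoff equal to `1` on `(-∞, s]` and to `0` on `[s + ε, ∞)`. -/
noncomputable def cutoff (s ε l : ℝ) : ℝ := max 0 (1 - max 0 (l - s) / ε)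

theorem continuous_cutoff (s ε : ℝ) : Continuous (cutoff s ε) := by
  unfold cutoff
  fun_prop

theorem cutoff_nonneg (s ε l : ℝ) : 0 ≤ cutoff s ε l := le_max_left _ _

theorem cutoff_le_one {ε : ℝ} (hε : 0 < ε) (s l : ℝ) : cutoff s ε l ≤ 1 :=
  max_le zero_le_one (sub_le_self _ (div_nonneg (le_max_left _ _) hε.le))

theorem cutoff_eq_one {s l : ℝ} (h : l ≤ s) (ε : ℝ) : cutoff s ε l = 1 := by
  simp [cutoff, max_eq_left (sub_nonpos.2 h)]

theorem cutoff_eq_zero {s ε l : ℝ} (hε : 0 < ε) (h : s + ε ≤ l) : cutoff s ε l = 0 := by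
  refine max_eq_left (sub_nonpos.2 ?_)
  rw [le_div_iff₀ hε]
  exact le_max_of_le_right (by linarith)

theorem mul_cutoff_sq_le {ε : ℝ} (hε : 0 < ε) (s l : ℝ) :
    l * cutoff s ε l ^ 2 ≤ (s + ε) * cutoff s ε l ^ 2 := by
  rcases le_total l (s + ε) with h | h
  · exact mul_le_mul_of_nonneg_right h (sq_nonneg _)
  · simp [cutoff_eq_zero hε h]

/-- The distribution function of a spectral measure of `1 - σ P` at `e_x`. -/
theorem spectralMeasure_le [Nontrivial V] (G : WeightedGraph V)
    (hw : ∀ x y, G.graph.Adj x y → 1 ≤ G.weight x y) (x : V) {c D : ℝ} (hc : 0 < c) (hD : 1 ≤ D)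
    (hvol : ∀ r : ℕ, ENNReal.ofReal (c * ((r : ℝ) + 1) ^ D) ≤ G.vol (G.ball x r))
    {ν : Measure ℝ} [IsFiniteMeasure ν] (hsupp : ∀ᵐ p ∂ν, p ∈ spectrum ℝ G.transitionOp)
    (hν : ∀ f : ℝ → ℝ, Continuous f →
      ∫ p, f p ∂ν = (inner ℂ (G.unitVec x) (cfc f G.transitionOp (G.unitVec x))).re)
    {σ : ℝ} (hσ : |σ| = 1) {s : ℝ} (hs : 0 < s) :
    ν {p | 1 - σ * p ≤ s} ≤
      ENNReal.ofReal (growthConst c D * G.vertexWeight x * s ^ (D / (D + 1))) := by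
  have hP := G.transitionOp_isSelfAdjoint
  have hD1 : 0 < D / (D + 1) := by positivity
  have hint : ∀ f : ℝ → ℝ, Continuous f → Integrable f ν := by
    intro f hf
    obtain ⟨C, hC⟩ := isCompact_Icc.exists_bound_of_continuousOn (s := Set.Icc (-1 : ℝ) 1)
      hf.continuousOn
    refine Integrable.of_bound hf.aestronglyMeasurable C (hsupp.mono fun p hp => hC p ?_)
    exact spectrum_subset_Icc_of_norm_le_one G.norm_transitionOp_le_one hp
  have key : ∀ ε : ℝ, 0 < ε → ν {p | 1 - σ * p ≤ s} ≤
      ENNReal.ofReal (growthConst c D * G.vertexWeight x * (s + ε) ^ (D / (D + 1))) := by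
    intro ε hε
    -- A continuous substitute for the spectral projection, so that `g(P)` lies in the continuous
    -- functional calculus and `hν` computes its moments.
    set g : ℝ → ℝ := fun p => cutoff s ε (1 - σ * p) with hg
    have hgc : Continuous g := (continuous_cutoff s ε).comp (by fun_prop)
    set f := cfc g G.transitionOp (G.unitVec x) with hf
    have hadj : ∀ A : G.L2 →L[ℂ] G.L2, inner ℂ f (A f) = inner ℂ (G.unitVec x)
        ((cfc g G.transitionOp * A * cfc g G.transitionOp) (G.unitVec x)) := by
      intro A
      have hsa : IsSelfAdjoint (cfc g G.transitionOp) := cfc_predicate g G.transitionOp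
      exact (ContinuousLinearMap.isSelfAdjoint_iff_isSymmetric.1 hsa) (G.unitVec x) (A f)
    have hnorm : ‖f‖ ^ 2 = ∫ p, g p ^ 2 ∂ν := by
      have h1 := hadj 1
      rw [mul_one, ← cfc_mul g g G.transitionOp hgc.continuousOn hgc.continuousOn] at h1
      simp only [← sq] at h1
      rw [hν (fun p => g p ^ 2) (hgc.pow 2), ← h1]
      exact (inner_self_eq_norm_sq (𝕜 := ℂ) f).symm
    have henergy : (inner ℂ f (G.transitionOp f)).re = ∫ p, p * g p ^ 2 ∂ν := by
      have h1 := hadj G.transitionOp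
      have h2 : cfc g G.transitionOp * G.transitionOp * cfc g G.transitionOp =
          cfc (fun p => p * g p ^ 2) G.transitionOp := by
        have e : (fun p => p * g p ^ 2) = fun p => g p * p * g p := by
          funext p
          ring
        rw [e, cfc_mul (fun p => g p * p) g G.transitionOp (by fun_prop) (by fun_prop),
          cfc_mul g (fun p => p) G.transitionOp (by fun_prop) (by fun_prop),
          cfc_id' ℝ G.transitionOp hP]
      rw [hν (fun p => p * g p ^ 2) (continuous_id.mul (hgc.pow 2)), h1, h2]
    have hfe : ∫ p, g p ∂ν = (inner ℂ (G.unitVec x) f).re := hν g hgc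
    have hle : ‖f‖ ^ 2 ≤ growthConst c D * G.vertexWeight x * (s + ε) ^ (D / (D + 1)) := by
      refine G.norm_sq_le_of_energy_le hw x hc hD hvol hσ (by positivity) f ?_ ?_
      · rw [hnorm, henergy, ← integral_const_mul, ← integral_const_mul, ← integral_sub
          (hint _ (by fun_prop)) (hint _ (by fun_prop))]
        refine integral_mono (hint _ (by fun_prop)) (hint _ (by fun_prop)) fun p => ?_
        have := mul_cutoff_sq_le hε s (1 - σ * p)
        simp only [hg]
        linarith
      -- Here `g² ≤ g` replaces the idempotence of a projection: `‖f‖² = ∫ g² ≤ ∫ g = ⟨e_x, f⟩`.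
      · refine le_trans ?_ (G.re_inner_unitVec_le x f)
        rw [hnorm, ← hfe]
        refine integral_mono (hint _ (by fun_prop)) (hint _ (by fun_prop)) fun p => ?_
        have h0 := cutoff_nonneg s ε (1 - σ * p)
        have h1 := cutoff_le_one hε s (1 - σ * p)
        simp only [hg]
        nlinarith
    refine le_trans ?_ (ENNReal.ofReal_le_ofReal hle)
    have hms : MeasurableSet {p : ℝ | 1 - σ * p ≤ s} :=
      measurableSet_le (by fun_prop) measurable_const
    rw [hnorm, ofReal_integral_eq_lintegral_ofReal (hint _ (by fun_prop))
      (Filter.Eventually.of_forall fun p => sq_nonneg _), ← lintegral_indicator_one hms]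
    refine lintegral_mono fun p => ?_
    by_cases hp : 1 - σ * p ≤ s
    · rw [Set.indicator_of_mem (show p ∈ {p : ℝ | 1 - σ * p ≤ s} from hp)]
      simp [hg, cutoff_eq_one hp]
    · rw [Set.indicator_of_notMem (show p ∉ {p : ℝ | 1 - σ * p ≤ s} from hp)]
      exact zero_le
  have hlim : Filter.Tendsto (fun ε : ℝ => ENNReal.ofReal
      (growthConst c D * G.vertexWeight x * (s + ε) ^ (D / (D + 1))))
      (nhdsWithin 0 (Set.Ioi 0))
      (nhds (ENNReal.ofReal (growthConst c D * G.vertexWeight x * s ^ (D / (D + 1))))) := by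
    refine ENNReal.tendsto_ofReal (Filter.Tendsto.const_mul _ ?_)
    have h : Filter.Tendsto (fun ε : ℝ => s + ε) (nhdsWithin 0 (Set.Ioi 0)) (nhds (s + 0)) :=
      (continuous_const.add continuous_id).continuousAt.tendsto.mono_left nhdsWithin_le_nhds
    rw [add_zero] at h
    exact h.rpow_const (Or.inl hs.ne')
  exact ge_of_tendsto hlim (eventually_mem_nhdsWithin.mono key)

/-- The Laplace bound is applied to the image of `ν` under `p ↦ 1 - σp`, restricted so that it lives
on `[0, ∞)`. -/
theorem lintegral_spectralMeasure_le [Nontrivial V] (G : WeightedGraph V)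
    (hw : ∀ x y, G.graph.Adj x y → 1 ≤ G.weight x y) (x : V) {c D : ℝ} (hc : 0 < c) (hD : 1 ≤ D)
    (hvol : ∀ r : ℕ, ENNReal.ofReal (c * ((r : ℝ) + 1) ^ D) ≤ G.vol (G.ball x r))
    {ν : Measure ℝ} [IsFiniteMeasure ν] (hsupp : ∀ᵐ p ∂ν, p ∈ spectrum ℝ G.transitionOp)
    (hν : ∀ f : ℝ → ℝ, Continuous f →
      ∫ p, f p ∂ν = (inner ℂ (G.unitVec x) (cfc f G.transitionOp (G.unitVec x))).re)
    {σ : ℝ} (hσ : |σ| = 1) {t : ℝ} (ht : 0 < t) :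
    ∫⁻ p in {p | 0 ≤ 1 - σ * p}, ENNReal.ofReal (Real.exp (-(t * (1 - σ * p)))) ∂ν ≤
      ENNReal.ofReal (growthConst c D * G.vertexWeight x *
        Real.Gamma (D / (D + 1) + 1) * t ^ (-(D / (D + 1)))) := by
  have hm : Measurable fun p : ℝ => 1 - σ * p := by fun_prop
  have hms : MeasurableSet {p : ℝ | 0 ≤ 1 - σ * p} := measurableSet_le measurable_const hm
  have h := lintegral_exp_neg_mul_le (ν := (ν.restrict {p | 0 ≤ 1 - σ * p}).map fun p => 1 - σ * p)
    (B := growthConst c D * G.vertexWeight x) (a := D / (D + 1)) (t := t)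
    (mul_nonneg (growthConst_pos hc hD).le (G.vertexWeight_nonneg x)) (by positivity) ht ?_ ?_
  · rwa [lintegral_map (by fun_prop) hm] at h
  · rw [ae_map_iff hm.aemeasurable measurableSet_Ici]
    exact ae_restrict_mem hms
  · intro s hs
    rw [Measure.map_apply hm measurableSet_Iic]
    exact (Measure.restrict_apply_le _ _).trans
      (G.spectralMeasure_le hw x hc hD hvol hsupp hν hσ hs)

/-- `Γ(a + 1) = a Γ(a)` with `a = D/(D+1)` turns the constant of the spectral bound into that of the
heat kernel bound. -/
theorem growthConst_mul_Gamma {c D : ℝ} (hc : 0 < c) (hD : 1 ≤ D) :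
    growthConst c D * Real.Gamma (D / (D + 1) + 1) =
      (D + 1) / (c ^ (1 / (D + 1)) * D ^ ((D - 1) / (D + 1))) * Real.Gamma (D / (D + 1)) := by
  have hD0 : 0 < D := by linarith
  have hD1 : 0 < D + 1 := by linarith
  have e : D ^ (2 * D / (D + 1)) = D ^ ((D - 1) / (D + 1)) * D := by
    conv_rhs => rw [← Real.rpow_add_one hD0.ne']
    congr 1
    field_simp
    ring
  rw [Real.Gamma_add_one (by positivity), growthConst, e]
  field_simp

end WeightedGraph

/-! ### Return probabilities. -/

theorem pow_le_exp_neg_mul_one_sub {p : ℝ} (hp : 0 ≤ p) (t : ℕ) :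
    p ^ t ≤ Real.exp (-(t * (1 - p))) := by
  have h := Real.add_one_le_exp (p - 1)
  calc p ^ t ≤ Real.exp (p - 1) ^ t := pow_le_pow_left₀ hp (by linarith) t
    _ = _ := by rw [← Real.exp_nat_mul]; congr 1; ring

namespace WeightedGraph

variable {V : Type*}

/-- In `∫ p^t dν`, the part over `[0, 1]` is governed by `σ = 1` and the part over `[-1, 0]` by `σ =
-1`; for odd `t` the integrand is nonpositive on the latter. -/
theorem heatKernel_le [Nontrivial V] (G : WeightedGraph V)
    (hw : ∀ x y, G.graph.Adj x y → 1 ≤ G.weight x y) (x : V) {c D : ℝ} (hc : 0 < c) (hD : 1 ≤ D)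
    (hvol : ∀ r : ℕ, ENNReal.ofReal (c * ((r : ℝ) + 1) ^ D) ≤ G.vol (G.ball x r))
    {t : ℕ} (ht : 1 ≤ t) :
    G.heatKernel t x x ≤ 2 * (growthConst c D * G.vertexWeight x *
        Real.Gamma (D / (D + 1) + 1) * (t : ℝ) ^ (-(D / (D + 1)))) ∧
    (Odd t → G.heatKernel t x x ≤ growthConst c D * G.vertexWeight x *
        Real.Gamma (D / (D + 1) + 1) * (t : ℝ) ^ (-(D / (D + 1)))) := by
  obtain ⟨ν, hfin, hsupp, hν⟩ :=
    exists_spectralMeasure G.transitionOp_isSelfAdjoint (G.unitVec x)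
  have ht0 : (0 : ℝ) < t := by exact_mod_cast ht
  set M := growthConst c D * G.vertexWeight x *
    Real.Gamma (D / (D + 1) + 1) * (t : ℝ) ^ (-(D / (D + 1))) with hM
  have hM0 : 0 ≤ M := by
    have := growthConst_pos hc hD
    have := G.vertexWeight_nonneg x
    have := Real.Gamma_pos_of_pos (show 0 < D / (D + 1) + 1 by positivity)
    positivity
  have hp : G.heatKernel t x x = ∫ p, p ^ t ∂ν := by
    rw [hν _ (by fun_prop), cfc_pow_id _ _ G.transitionOp_isSelfAdjoint, heatKernel_self_eq]
  have hIcc : ∀ᵐ p ∂ν, p ∈ Set.Icc (-1 : ℝ) 1 := hsupp.mono fun p hp =>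
    spectrum_subset_Icc_of_norm_le_one G.norm_transitionOp_le_one hp
  have hle : ∀ (h : ℝ → ENNReal), (∀ᵐ p ∂ν, ENNReal.ofReal (p ^ t) ≤ h p) → ∀ b : ℝ, 0 ≤ b →
      ∫⁻ p, h p ∂ν ≤ ENNReal.ofReal b → G.heatKernel t x x ≤ b := by
    intro h hph b hb hhb
    rw [hp]
    have hi : Integrable (fun p : ℝ => p ^ t) ν := by
      refine Integrable.of_bound (by fun_prop) 1 (hIcc.mono fun p hp => ?_)
      rw [norm_pow]
      exact pow_le_one₀ (norm_nonneg _) (abs_le.2 hp)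
    -- Only the positive part of `p^t` is kept; `ENNReal.ofReal` truncates negative values to `0`.
    rw [integral_eq_lintegral_pos_part_sub_lintegral_neg_part hi]
    refine (sub_le_self _ ENNReal.toReal_nonneg).trans ?_
    exact ENNReal.toReal_le_of_le_ofReal hb ((lintegral_mono_ae hph).trans hhb)
  have hms : ∀ σ : ℝ, MeasurableSet {p : ℝ | 0 ≤ 1 - σ * p} := fun σ =>
    measurableSet_le measurable_const (by fun_prop)
  set F : ℝ → ℝ → ENNReal := fun σ => {p : ℝ | 0 ≤ 1 - σ * p}.indicator
    fun p => ENNReal.ofReal (Real.exp (-(t * (1 - σ * p)))) with hF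
  have hFle : ∀ σ : ℝ, |σ| = 1 → ∫⁻ p, F σ p ∂ν ≤ ENNReal.ofReal M := by
    intro σ hσ
    rw [hF, lintegral_indicator (hms σ)]
    exact G.lintegral_spectralMeasure_le hw x hc hD hvol hsupp hν hσ ht0
  have hpos : ∀ p ∈ Set.Icc (-1 : ℝ) 1, 0 ≤ p → ENNReal.ofReal (p ^ t) ≤ F 1 p := by
    intro p hp hp0
    have hmem : p ∈ {p : ℝ | 0 ≤ 1 - 1 * p} := by simpa using hp.2
    simp only [hF, Set.indicator_of_mem hmem]
    refine ENNReal.ofReal_le_ofReal ?_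
    rw [one_mul]
    exact pow_le_exp_neg_mul_one_sub hp0 t
  have hneg : ∀ p ∈ Set.Icc (-1 : ℝ) 1, p ≤ 0 → ENNReal.ofReal (p ^ t) ≤ F (-1) p := by
    intro p hp hp0
    have hmem : p ∈ {p : ℝ | 0 ≤ 1 - (-1) * p} := by
      have := hp.1
      simp only [Set.mem_ofPred_eq]
      linarith
    simp only [hF, Set.indicator_of_mem hmem]
    refine ENNReal.ofReal_le_ofReal ?_
    have h1 := pow_le_exp_neg_mul_one_sub (neg_nonneg.2 hp0) t
    rw [neg_one_mul]
    refine le_trans ((le_abs_self _).trans_eq ?_) h1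
    rw [abs_pow, abs_of_nonpos hp0]
  constructor
  · refine hle (fun p => F 1 p + F (-1) p) (hIcc.mono fun p hp => ?_) _ (by positivity) ?_
    · rcases le_total 0 p with h | h
      · exact (hpos p hp h).trans le_self_add
      · exact (hneg p hp h).trans le_add_self
    · rw [lintegral_add_left ((Measurable.indicator (by fun_prop) (hms 1))), two_mul,
        ENNReal.ofReal_add hM0 hM0]
      exact add_le_add (hFle 1 abs_one) (hFle (-1) (by simp))
  · intro hodd
    refine hle (F 1) (hIcc.mono fun p hp => ?_) _ hM0 (hFle 1 abs_one)
    rcases le_total 0 p with h | h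
    · exact hpos p hp h
    · rw [ENNReal.ofReal_of_nonpos (hodd.pow_nonpos h)]
      exact zero_le

end WeightedGraph

theorem mainTheorem4 {V : Type*} [Infinite V] (G : WeightedGraph V)
    (hbip : ¬ G.graph.IsBipartite)
    (hw : ∀ x y, G.graph.Adj x y → 1 ≤ G.weight x y)
    (x : V) (c D : ℝ) (hc : 0 < c) (hD : 1 ≤ D)
    (hvol : ∀ r : ℕ, ENNReal.ofReal (c * ((r : ℝ) + 1) ^ D) ≤ G.vol (G.ball x r)) :
    (∀ δ ∈ Set.Ioo (0 : ℝ) 2,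
      G.spectralMeasureStar x δ ≤
        (D + 1) ^ 2 / (c ^ (1 / (D + 1)) * D ^ (2 * D / (D + 1))) *
          G.vertexWeight x * δ ^ (D / (D + 1)) ∧
      G.spectralMeasureSignless x δ ≤
        (D + 1) ^ 2 / (c ^ (1 / (D + 1)) * D ^ (2 * D / (D + 1))) *
          G.vertexWeight x * δ ^ (D / (D + 1))) ∧
    (∀ t : ℕ, 1 ≤ t →
      (Even t → G.heatKernel t x x ≤
        2 * ((D + 1) / (c ^ (1 / (D + 1)) * D ^ ((D - 1) / (D + 1))) *
          Real.Gamma (D / (D + 1))) * G.vertexWeight x * (t : ℝ) ^ (-(D / (D + 1)))) ∧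
      (Odd t → G.heatKernel t x x ≤
        ((D + 1) / (c ^ (1 / (D + 1)) * D ^ ((D - 1) / (D + 1))) *
          Real.Gamma (D / (D + 1))) * G.vertexWeight x * (t : ℝ) ^ (-(D / (D + 1))))) := by
  refine ⟨fun δ hδ => ⟨G.spectralMeasureStar_le hw x hc hD hvol hδ.1,
    G.spectralMeasureSignless_le hw x hc hD hvol hδ.1⟩, fun t ht => ?_⟩
  obtain ⟨heven, hodd⟩ := G.heatKernel_le hw x hc hD hvol ht
  rw [← WeightedGraph.growthConst_mul_Gamma hc hD]
  exact ⟨fun _ => heven.trans_eq (by ring), fun h => (hodd h).trans_eq (by ring)⟩
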